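/- **Theorem B.** Let $(G,H;\Gamma)$ be an abelian cut-and-project scheme: $G$ and $H$ are locally compact second countable (Hausdorff) abelian groups, written additively, with fixed Haar measures $m_G,m_H$, and $\Gamma<G\times H$ is a lattice (a discrete subgroup of finite covolume with respect to $m_G\otimes m_H$) such that $\mathrm{proj}_G|_\Gamma$ is injective and $\mathrm{proj}_H(\Gamma)$ is dense in $H$. Let $\Xi=\Gamma\backslash(G\times H)$ with its Haar probability measure $\xi$ and the $G$-action $g_0.\Gamma(g,h)=\Gamma(g-g_0,h)$. Let $W\subset H$ be a window, i.e. a relatively compact Borel set with $m_H(\partial W)=0$ (Jordan measurability) and $0<m_H(W)<\infty$, and put $Y_W=\{\Gamma(0,w):w\in W\}\subset\Xi$ (and similarly $Y_{W^\circ}$ for the interior $W^\circ$ of $W$). For a probability preserving Borel $G$-space $(X,\mu)$, a Borel set $Y\subset X$ and $x\in X$ put $Y_x=\{g\in G: g.x\in Y\}$. The triple $(X,\mu,Y)$ is a transverse $G$-space if all sets $Y_x$ are nonempty and locally finite and $\int_X|Y_x\cap K|\,d\mu(x)<\infty$ for all compact $K\subset G$. The transverse measure $\mu_Y$ is the unique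 $\sigma$-finite Borel measure on $Y$ with $$\int_{G\times Y} f\,d(m_G\otimes\mu_Y)=\int_X\sum_{g\in Y_x}f(-g,g.x)\,d\mu(x)$$ for all Borel $f:G\times Y\to[0,\infty]$, and the intensity of $Y$ is $\iota_\mu(Y)=\mu_Y(Y)$. The intersection covolume is $I_\mu(Y)=\iota_{\mu\otimes\mu}(Y^{[2]})$, where $Y^{[2]}=\{(h.y,h.y'):h\in G,\ y,y'\in Y\}$ and $G$ acts on the first coordinate of $X\times X$. Then $(\Xi,\xi,Y_W)$ and $(\Xi\times\Xi,\xi\otimes\xi,Y_W^{[2]})$ are transverse $G$-spaces, each with a unique transverse measure, and: 1. $\iota_\xi(Y_W)=\mathrm{covol}_{G\times H}(\Gamma)^{-1}\cdot m_H(W)$, and $\iota_\xi(Y_{W^\circ})=\iota_\xi(Y_W)$. 2. If $W$ is open or $W-W$ is Jordan measurable (that is, $m_H(\partial(W-W))=0$), then $$\mathrm{covol}_{G\times H}(\Gamma)^{-1}\cdot m_H(W^\circ-W^\circ)\le I_\xi(Y_W)\le \mathrm{covol}_{G\times H}(\Gamma)^{-1}\cdot m_H(W-W).$$ -/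

import Mathlib

open MeasureTheory Set
open scoped ENNReal Pointwise

noncomputable section

/-! ## Borel `G`-spaces, cross sections and transverse measures (additive notation) -/

/-- A Borel action of an additive group `G` on a measurable space `X`. -/
structure BorelAction (G X : Type*) [AddGroup G] [MeasurableSpace G] [MeasurableSpace X] where
  act : G → X → X
  zero_act : ∀ x, act 0 x = x
  add_act : ∀ g h x, act (g + h) x = act g (act h x)
  measurable_act : Measurable fun p : G × X => act p.1 p.2

namespace BorelAction

/-- The action of `G` on `X × X` on the first coordinate: `g • (x, x') = (g • x, x')`. -/
def onFst {G X : Type*} [AddGroup G] [MeasurableSpace G] [MeasurableSpace X]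
    (α : BorelAction G X) : BorelAction G (X × X) where
  act g p := (α.act g p.1, p.2)
  zero_act p := by simp [α.zero_act]
  add_act g h p := by simp [α.add_act]
  measurable_act := by
    refine Measurable.prodMk ?_ (measurable_snd.comp measurable_snd)
    exact α.measurable_act.comp
      (measurable_fst.prodMk (measurable_fst.comp measurable_snd))

end BorelAction

/-- The return times set `Y_x = {g | g • x ∈ Y}`. -/
def returnTimes {G X : Type*} [AddGroup G] [MeasurableSpace G] [MeasurableSpace X]
    (α : BorelAction G X) (Y : Set X) (x : X) : Set G :=
  {g | α.act g x ∈ Y}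

/-- A cross section: a Borel set all of whose return times sets are nonempty and locally finite. -/
structure IsCrossSection {G X : Type*} [AddGroup G] [TopologicalSpace G] [MeasurableSpace G]
    [MeasurableSpace X] (α : BorelAction G X) (Y : Set X) : Prop where
  measurableSet : MeasurableSet Y
  nonempty : ∀ x, (returnTimes α Y x).Nonempty
  locallyFinite : ∀ x, ∀ K : Set G, IsCompact K → (returnTimes α Y x ∩ K).Finite

/-- A transverse `G`-space `(X, μ, Y)`: a probability preserving `G`-space together with a
locally integrable cross section. -/
structure IsTransverseSpace {G X : Type*} [AddGroup G] [TopologicalSpace G] [MeasurableSpace G]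
    [MeasurableSpace X] (α : BorelAction G X) (μ : Measure X) (Y : Set X) : Prop where
  isProbabilityMeasure : IsProbabilityMeasure μ
  measurePreserving : ∀ g, MeasurePreserving (α.act g) μ μ
  isCrossSection : IsCrossSection α Y
  locallyIntegrable : ∀ K : Set G, IsCompact K →
    ∫⁻ x, ((returnTimes α Y x ∩ K).encard : ℝ≥0∞) ∂μ < ∞

/-- The periodization `f_X x = ∑_{g ∈ Y_x} f (g⁻¹, g • x)` of `f : G × Y → [0, ∞]`. -/
def periodization {G X : Type*} [AddGroup G] [MeasurableSpace G] [MeasurableSpace X]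
    (α : BorelAction G X) (Y : Set X) (f : G × Y → ℝ≥0∞) (x : X) : ℝ≥0∞ :=
  ∑' g : returnTimes α Y x, f (-(g : G), ⟨α.act g x, g.2⟩)

/-- `ν` is a transverse measure on `Y`: the Campbell formula `(m ⊗ ν)(f) = μ(f_X)` holds for all
Borel `f : G × Y → [0, ∞]`. Here `m` is the fixed Haar measure of `G`. -/
structure IsTransverseMeasure {G X : Type*} [AddGroup G] [MeasurableSpace G] [MeasurableSpace X]
    (m : Measure G) (α : BorelAction G X) (μ : Measure X) (Y : Set X) (ν : Measure Y) : Prop where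
  sigmaFinite : SigmaFinite ν
  campbell : ∀ f : G × Y → ℝ≥0∞, Measurable f →
    ∫⁻ p, f p ∂(m.prod ν) = ∫⁻ x, periodization α Y f x ∂μ

open Classical in
/-- The transverse measure `μ_Y` (the zero measure if there is none). -/
def transverseMeasure {G X : Type*} [AddGroup G] [MeasurableSpace G] [MeasurableSpace X]
    (m : Measure G) (α : BorelAction G X) (μ : Measure X) (Y : Set X) : Measure Y :=
  if h : ∃ ν, IsTransverseMeasure m α μ Y ν then h.choose else 0

/-- The intensity `ι_μ(Y) = μ_Y(Y)`. -/
def intensity {G X : Type*} [AddGroup G] [MeasurableSpace G] [MeasurableSpace X]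
    (m : Measure G) (α : BorelAction G X) (μ : Measure X) (Y : Set X) : ℝ≥0∞ :=
  transverseMeasure m α μ Y univ

/-- `Y^[2]`, the saturation of `Y × Y` under the diagonal action of `G` on `X × X`. -/
def intersectionSection {G X : Type*} [AddGroup G] [MeasurableSpace G] [MeasurableSpace X]
    (α : BorelAction G X) (Y : Set X) : Set (X × X) :=
  {p | ∃ h : G, ∃ y ∈ Y, ∃ y' ∈ Y, p = (α.act h y, α.act h y')}

/-- The intersection covolume `I_μ(Y) = ι_{μ ⊗ μ}(Y^[2])`, where `G` acts on the first coordinate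
of `X × X`. -/
def intersectionCovolume {G X : Type*} [AddGroup G] [MeasurableSpace G] [MeasurableSpace X]
    (m : Measure G) (α : BorelAction G X) (μ : Measure X) (Y : Set X) : ℝ≥0∞ :=
  intensity m α.onFst (μ.prod μ) (intersectionSection α Y)

/-! ## Lattices, cut-and-project schemes and windows -/

/-- `Γ` is a lattice in the abelian group `A` with Haar measure `m`: a discrete subgroup that
admits a fundamental domain of finite measure. -/
structure IsLattice {A : Type*} [AddCommGroup A] [TopologicalSpace A] [MeasurableSpace A]
    (m : Measure A) (Γ : AddSubgroup A) : Prop where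
  discrete : DiscreteTopology Γ
  finite_covolume : ∃ F : Set A, IsAddFundamentalDomain Γ F m ∧ m F < ∞

/-- An abelian cut-and-project scheme `(G, H; Γ)`. The groups `G` and `H` carry fixed Haar measures
`mG` and `mH`. -/
structure CutAndProjectScheme {G H : Type*}
    [AddCommGroup G] [TopologicalSpace G] [MeasurableSpace G]
    [AddCommGroup H] [TopologicalSpace H] [MeasurableSpace H]
    (mG : Measure G) (mH : Measure H) where
  Γ : AddSubgroup (G × H)
  isLattice : IsLattice (mG.prod mH) Γ
  injOn_fst : InjOn Prod.fst (Γ : Set (G × H))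
  dense_snd : Dense (Prod.snd '' (Γ : Set (G × H)))

/-- Locally compact second countable groups are Polish. -/
theorem polishSpace_of_lcsc (A : Type*) [AddCommGroup A] [TopologicalSpace A]
    [IsTopologicalAddGroup A] [LocallyCompactSpace A] [SecondCountableTopology A] [T2Space A] :
    PolishSpace A := by
  let : UniformSpace A := IsTopologicalAddGroup.rightUniformSpace A
  have : IsUniformAddGroup A := isUniformAddGroup_of_addCommGroup
  have : CompleteSpace A := IsRightUniformAddGroup.completeSpace_of_weaklyLocallyCompactSpace
  have : (uniformity A).IsCountablyGenerated :=
    IsUniformAddGroup.uniformity_countably_generated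
  infer_instance

namespace CutAndProjectScheme

variable {G H : Type*}
  [AddCommGroup G] [TopologicalSpace G] [IsTopologicalAddGroup G] [LocallyCompactSpace G]
  [SecondCountableTopology G] [T2Space G] [MeasurableSpace G] [BorelSpace G]
  [AddCommGroup H] [TopologicalSpace H] [IsTopologicalAddGroup H] [LocallyCompactSpace H]
  [SecondCountableTopology H] [T2Space H] [MeasurableSpace H] [BorelSpace H]
  {mG : Measure G} {mH : Measure H} (S : CutAndProjectScheme mG mH)

/-- The covolume of `Γ` in `G × H`: the measure of a fundamental domain. -/
def covol : ℝ≥0∞ := addCovolume S.Γ (G × H) (mG.prod mH)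

/-- The space `Ξ = Γ \ (G × H)`. -/
abbrev Space : Type _ := (G × H) ⧸ S.Γ

instance instIsClosed : IsClosed (S.Γ : Set (G × H)) := by
  have := S.isLattice.discrete
  exact AddSubgroup.isClosed_of_discrete

instance instBorelSpace : BorelSpace S.Space := by
  have := polishSpace_of_lcsc G
  have := polishSpace_of_lcsc H
  exact QuotientAddGroup.borelSpace

/-- The Haar probability measure `ξ` on `Ξ`. -/
def haarProb : Measure S.Space :=
  ((Measure.addHaar : Measure S.Space) univ)⁻¹ • Measure.addHaar

/-- The action of `G` on `Ξ`: `g₀ • Γ(g, h) = Γ(g - g₀, h)`. -/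
def action : BorelAction G S.Space where
  act g₀ x := x + QuotientAddGroup.mk (-g₀, 0)
  zero_act x := by
    have : ((-0, 0) : G × H) = 0 := by simp
    rw [this, QuotientAddGroup.mk_zero, add_zero]
  add_act g h x := by
    have : ((-(g + h), 0) : G × H) = (-h, 0) + (-g, 0) := by simp
    rw [this, QuotientAddGroup.mk_add, add_assoc]
  measurable_act := by
    apply Continuous.measurable
    exact continuous_snd.add
      (QuotientAddGroup.continuous_mk.comp (continuous_fst.neg.prodMk continuous_const))

/-- The cross section `Y_W = {Γ(0, w) | w ∈ W}`. -/
def crossSection (W : Set H) : Set S.Space :=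
  (fun w : H => (QuotientAddGroup.mk ((0 : G), w) : S.Space)) '' W

end CutAndProjectScheme

/-- Jordan measurability: the topological boundary is a null set. -/
def IsJordanMeasurable {H : Type*} [TopologicalSpace H] [MeasurableSpace H] (m : Measure H)
    (W : Set H) : Prop :=
  m (frontier W) = 0

/-- A window: a relatively compact Jordan measurable Borel set with `0 < m(W) < ∞`. -/
structure IsWindow {H : Type*} [TopologicalSpace H] [MeasurableSpace H] (m : Measure H)
    (W : Set H) : Prop where
  measurableSet : MeasurableSet W
  relativelyCompact : IsCompact (closure W)
  jordan : IsJordanMeasurable m W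
  measure_pos : 0 < m W
  measure_lt_top : m W < ∞

end

/-!
The point `Γp` of `Ξ` returns to `Y_W` exactly at the `G`-coordinates of the points of `Γ + p` whose
`H`-coordinate lies in `W`. Sums over return times are therefore sums over `Γ`, and
unfolding `∫_Ξ ∑_Γ = covol⁻¹ ∫_{G × H}` identifies the transverse measure of `Y_W` with
`covol⁻¹ • m_H` on `W`.

On `Ξ × Ξ` the `G`-action commutes with the shear `(z, y) ↦ (z + y, y)`. Hence the pairs whose
difference lies in `Y_D` form a cross section of intensity `covol⁻¹ * m_H(D)`. Differences of pairs
in `Y_W^[2]` lie in `Y_{W - W}`; conversely, by density of `proj_H(Γ)`, a pair whose difference lies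
in `Y_{U - U}` with `U ⊆ W` open has a common return time to `Y_U`, so belongs to `Y_W^[2]`.
-/

section Transverse

variable {G X : Type*} [AddGroup G] [MeasurableSpace G] [MeasurableSpace X]
  {m : Measure G} {α : BorelAction G X} {μ : Measure X} {Y Y' : Set X} {lam : Measure X}

theorem returnTimes_mono (h : Y ⊆ Y') (x : X) : returnTimes α Y x ⊆ returnTimes α Y' x :=
  fun _ hg => h hg

theorem mem_intersectionSection_iff {q : X × X} :
    q ∈ intersectionSection α Y ↔ (returnTimes α Y q.1 ∩ returnTimes α Y q.2).Nonempty := by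
  have act_neg_act : ∀ g x, α.act (-g) (α.act g x) = x := fun g x => by
    rw [← α.add_act, neg_add_cancel, α.zero_act]
  constructor
  · rintro ⟨g, y, hy, y', hy', rfl⟩
    exact ⟨-g, by rwa [returnTimes, mem_ofPred_eq, act_neg_act],
      by rwa [returnTimes, mem_ofPred_eq, act_neg_act]⟩
  · rintro ⟨g, hg, hg'⟩
    exact ⟨-g, _, hg, _, hg', by rw [act_neg_act, act_neg_act]⟩

theorem intersectionSection_mono (h : Y ⊆ Y') :
    intersectionSection α Y ⊆ intersectionSection α Y' :=
  fun _ ⟨g, y, hy, y', hy', hq⟩ => ⟨g, y, h hy, y', h hy', hq⟩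

theorem IsCrossSection.of_subset_of_subset [TopologicalSpace G] {Z : Set X}
    (hY : IsCrossSection α Y) (hY' : IsCrossSection α Y') (hZ : MeasurableSet Z)
    (hYZ : Y ⊆ Z) (hZY' : Z ⊆ Y') : IsCrossSection α Z where
  measurableSet := hZ
  nonempty x := (hY.nonempty x).mono (returnTimes_mono hYZ x)
  locallyFinite x K hK :=
    (hY'.locallyFinite x K hK).subset (inter_subset_inter_left K (returnTimes_mono hZY' x))

/-- The sum `∑_{g ∈ Y_x} F (-g, g • x)`: the periodization of a function `F` on all of `G × X`. -/
noncomputable def returnSum (α : BorelAction G X) (Y : Set X) (F : G × X → ℝ≥0∞) (x : X) : ℝ≥0∞ :=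
  ∑' g : returnTimes α Y x, F (-(g : G), α.act g x)

/-- The Campbell formula for a measure `lam` on the ambient space `X` instead of the subspace `Y`.
Neither finiteness properties of `Y` nor `lam Yᶜ = 0` are part of the definition. -/
def HasCampbellFormula (m : Measure G) (α : BorelAction G X) (μ : Measure X) (Y : Set X)
    (lam : Measure X) : Prop :=
  ∀ F : G × X → ℝ≥0∞, Measurable F → ∫⁻ p, F p ∂(m.prod lam) = ∫⁻ x, returnSum α Y F x ∂μ

theorem returnSum_indicator (hYY' : Y ⊆ Y') (F : G × X → ℝ≥0∞) (x : X) :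
    returnSum α Y' ((univ ×ˢ Y).indicator F) x = returnSum α Y F x := by
  have hind : ∀ g : G, (univ ×ˢ Y).indicator F (-g, α.act g x) =
      (returnTimes α Y x).indicator (fun g => F (-g, α.act g x)) g := fun g => by
    rw [← indicator_comp_right fun g => (-g, α.act g x), mk_preimage_prod]
    simp only [preimage_univ, univ_inter]
    rfl
  simp_rw [returnSum, hind]
  rw [tsum_subtype (returnTimes α Y' x)
      ((returnTimes α Y x).indicator fun g => F (-g, α.act g x)),
    tsum_subtype (returnTimes α Y x) fun g => F (-g, α.act g x), indicator_indicator,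
    inter_eq_right.2 (returnTimes_mono hYY' x)]

theorem HasCampbellFormula.restrict [SFinite m] [SFinite lam]
    (h : HasCampbellFormula m α μ Y' lam) (hYY' : Y ⊆ Y') (hY : MeasurableSet Y) :
    HasCampbellFormula m α μ Y (lam.restrict Y) := fun F hF => by
  have hmeas : MeasurableSet ((univ : Set G) ×ˢ Y) := MeasurableSet.univ.prod hY
  calc ∫⁻ p, F p ∂(m.prod (lam.restrict Y))
      = ∫⁻ p, F p ∂((m.prod lam).restrict (univ ×ˢ Y)) := by
        rw [← Measure.prod_restrict, Measure.restrict_univ]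
    _ = ∫⁻ p, (univ ×ˢ Y).indicator F p ∂(m.prod lam) := (lintegral_indicator hmeas F).symm
    _ = ∫⁻ x, returnSum α Y F x ∂μ := by
        rw [h _ (hF.indicator hmeas)]
        exact lintegral_congr (returnSum_indicator hYY' F)

theorem HasCampbellFormula.isTransverseMeasure [SFinite m] {ν : Measure Y} [SigmaFinite ν]
    (h : HasCampbellFormula m α μ Y (ν.map (↑))) (hY : MeasurableSet Y) :
    IsTransverseMeasure m α μ Y ν where
  sigmaFinite := inferInstance
  campbell f hf := by
    have hcoe : MeasurableEmbedding (Prod.map id (↑) : G × Y → G × X) :=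
      MeasurableEmbedding.id.prodMap (.subtype_coe hY)
    have extend_apply := hcoe.injective.extend_apply f 0
    have hmap : (m.prod ν).map (Prod.map id (↑)) = m.prod (ν.map ((↑) : Y → X)) := by
      rw [← Measure.map_prod_map _ _ measurable_id measurable_subtype_coe, Measure.map_id]
    rw [← lintegral_congr extend_apply, ← hcoe.lintegral_map, hmap,
      h _ (hcoe.measurable_extend hf measurable_zero)]
    exact lintegral_congr fun x => tsum_congr fun g => extend_apply (-(g : G), ⟨α.act g x, g.2⟩)

theorem HasCampbellFormula.isTransverseMeasure_comap [SFinite m] [SFinite lam]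
    (h : HasCampbellFormula m α μ Y' lam) (hYY' : Y ⊆ Y') (hY : MeasurableSet Y)
    (hlam : lam Y ≠ ∞) : IsTransverseMeasure m α μ Y (lam.comap (↑)) := by
  have hfin : IsFiniteMeasure (lam.comap ((↑) : Y → X)) :=
    ⟨by rw [comap_subtype_coe_apply hY, image_univ, Subtype.range_coe]; exact hlam.lt_top⟩
  refine HasCampbellFormula.isTransverseMeasure ?_ hY
  rw [(MeasurableEmbedding.subtype_coe hY).map_comap, Subtype.range_coe]
  exact h.restrict hYY' hY

theorem IsTransverseMeasure.unique [SigmaFinite m] [NeZero m] {ν ν' : Measure Y}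
    (h : IsTransverseMeasure m α μ Y ν) (h' : IsTransverseMeasure m α μ Y ν') : ν = ν' := by
  have := h.sigmaFinite
  have := h'.sigmaFinite
  obtain ⟨K, hK, -, hK0, hKtop⟩ :=
    Measure.exists_subset_measure_lt_top .univ (Measure.measure_univ_pos.2 (NeZero.ne m))
  ext B hB
  have hKB : Measurable ((K ×ˢ B).indicator (1 : G × Y → ℝ≥0∞)) :=
    measurable_one.indicator (hK.prod hB)
  have hprod : m K * ν B = m K * ν' B := by
    rw [← Measure.prod_prod, ← Measure.prod_prod, ← lintegral_indicator_one (hK.prod hB),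
      ← lintegral_indicator_one (hK.prod hB), h.campbell _ hKB, h'.campbell _ hKB]
  exact (ENNReal.mul_right_inj hK0.ne' hKtop.ne).1 hprod

theorem IsTransverseMeasure.existsUnique [SigmaFinite m] [NeZero m] {ν : Measure Y}
    (h : IsTransverseMeasure m α μ Y ν) : ∃! ν, IsTransverseMeasure m α μ Y ν :=
  ⟨ν, h, fun _ h' => h'.unique h⟩

theorem IsTransverseMeasure.intensity_eq [SigmaFinite m] [NeZero m] {ν : Measure Y}
    (h : IsTransverseMeasure m α μ Y ν) : intensity m α μ Y = ν univ := by
  have hex : ∃ ν, IsTransverseMeasure m α μ Y ν := ⟨ν, h⟩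
  rw [intensity, transverseMeasure, dif_pos hex, hex.choose_spec.unique h]

theorem HasCampbellFormula.intensity_eq [SigmaFinite m] [NeZero m] [SFinite lam]
    (h : HasCampbellFormula m α μ Y' lam) (hYY' : Y ⊆ Y') (hY : MeasurableSet Y)
    (hlam : lam Y ≠ ∞) : intensity m α μ Y = lam Y := by
  rw [(h.isTransverseMeasure_comap hYY' hY hlam).intensity_eq, comap_subtype_coe_apply hY,
    image_univ, Subtype.range_coe]

theorem encard_returnTimes_inter (K : Set G) (x : X) :
    ((returnTimes α Y x ∩ K).encard : ℝ≥0∞) = returnSum α Y (((-K) ×ˢ univ).indicator 1) x := by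
  have hind : ∀ g : G, ((-K) ×ˢ (univ : Set X)).indicator (1 : G × X → ℝ≥0∞) (-g, α.act g x) =
      K.indicator (fun _ => 1) g := fun g => by
    by_cases hg : g ∈ K <;> simp [hg]
  simp_rw [returnSum, hind]
  rw [tsum_subtype (returnTimes α Y x) (K.indicator fun _ => (1 : ℝ≥0∞)), indicator_indicator,
    ← tsum_subtype (returnTimes α Y x ∩ K) fun _ => (1 : ℝ≥0∞), ENNReal.tsum_set_one]

theorem HasCampbellFormula.lintegral_encard [MeasurableNeg G] [SFinite lam]
    (h : HasCampbellFormula m α μ Y lam) {K : Set G} (hK : MeasurableSet K) :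
    ∫⁻ x, ((returnTimes α Y x ∩ K).encard : ℝ≥0∞) ∂μ = m (-K) * lam univ := by
  have hKu : MeasurableSet ((-K) ×ˢ (univ : Set X)) := hK.neg.prod .univ
  simp_rw [encard_returnTimes_inter K]
  rw [← h _ (measurable_one.indicator hKu), lintegral_indicator_one hKu, Measure.prod_prod]

theorem HasCampbellFormula.isTransverseSpace [TopologicalSpace G] [T2Space G] [BorelSpace G]
    [ContinuousNeg G] [IsFiniteMeasureOnCompacts m] [SFinite m] [SFinite lam]
    [IsProbabilityMeasure μ] (h : HasCampbellFormula m α μ Y' lam)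
    (hμ : ∀ g, MeasurePreserving (α.act g) μ μ) (hY : IsCrossSection α Y) (hYY' : Y ⊆ Y')
    (hlam : lam Y ≠ ∞) : IsTransverseSpace α μ Y where
  isProbabilityMeasure := inferInstance
  measurePreserving := hμ
  isCrossSection := hY
  locallyIntegrable K hK := by
    rw [(h.restrict hYY' hY.measurableSet).lintegral_encard hK.measurableSet,
      Measure.restrict_apply_univ]
    exact ENNReal.mul_lt_top hK.neg.measure_lt_top hlam.lt_top

end Transverse

section Shear

variable {G X : Type*} [AddGroup G] [MeasurableSpace G] [AddGroup X] [MeasurableSpace X]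
  {α : BorelAction G X}

theorem BorelAction.act_sub (hα : ∀ g x y, α.act g (x + y) = α.act g x + y) (g : G) (x y : X) :
    α.act g x - y = α.act g (x - y) := by
  rw [sub_eq_add_neg, ← hα, ← sub_eq_add_neg]

theorem returnTimes_onFst_preimage_sub (hα : ∀ g x y, α.act g (x + y) = α.act g x + y)
    (Y : Set X) (p : X × X) :
    returnTimes α.onFst ((fun q => q.1 - q.2) ⁻¹' Y) p = returnTimes α Y (p.1 - p.2) := by
  ext g
  simp only [returnTimes, mem_ofPred_eq, mem_preimage, BorelAction.onFst, BorelAction.act_sub hα]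

theorem returnSum_onFst_preimage_sub (hα : ∀ g x y, α.act g (x + y) = α.act g x + y) (Y : Set X)
    (F : G × X × X → ℝ≥0∞) (x y : X) :
    returnSum α.onFst ((fun p => p.1 - p.2) ⁻¹' Y) F (x, y) =
      returnSum α Y (fun p => F (p.1, p.2 + y, y)) (x - y) := by
  rw [returnSum, returnTimes_onFst_preimage_sub hα]
  exact tsum_congr fun g => by simp [BorelAction.onFst, ← BorelAction.act_sub hα]

theorem IsCrossSection.preimage_sub [TopologicalSpace G] [MeasurableSub₂ X] {Y : Set X}
    (hα : ∀ g x y, α.act g (x + y) = α.act g x + y) (hY : IsCrossSection α Y) :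
    IsCrossSection α.onFst ((fun p : X × X => p.1 - p.2) ⁻¹' Y) where
  measurableSet := (measurable_fst.sub measurable_snd) hY.measurableSet
  nonempty p := by
    rw [returnTimes_onFst_preimage_sub hα]
    exact hY.nonempty _
  locallyFinite p K hK := by
    rw [returnTimes_onFst_preimage_sub hα]
    exact hY.locallyFinite _ K hK

/-- The measurable automorphism `(z, y) ↦ (z + y, y)` of `X × X`. It identifies the pairs whose
difference lies in `Y` with `Y × X`. -/
def shearEquiv (X : Type*) [AddGroup X] [MeasurableSpace X] [MeasurableAdd₂ X] [MeasurableSub₂ X] :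
    X × X ≃ᵐ X × X where
  toFun p := (p.1 + p.2, p.2)
  invFun p := (p.1 - p.2, p.2)
  left_inv p := by simp
  right_inv p := by simp
  measurable_toFun := (measurable_fst.add measurable_snd).prodMk measurable_snd
  measurable_invFun := (measurable_fst.sub measurable_snd).prodMk measurable_snd

variable [MeasurableAdd₂ X] [MeasurableSub₂ X]

theorem map_shearEquiv_preimage_sub (lam μ : Measure X) [SFinite μ] (B : Set X) :
    (lam.prod μ).map (shearEquiv X) ((fun p => p.1 - p.2) ⁻¹' B) = lam B * μ univ := by
  rw [MeasurableEquiv.map_apply, ← Measure.prod_prod]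
  congr 1
  ext p
  simp [shearEquiv]

theorem HasCampbellFormula.onFst_preimage_sub {m : Measure G} [SFinite m] {lam μ μ' : Measure X}
    [SFinite lam] [SFinite μ] [SFinite μ'] [μ.IsAddRightInvariant] {Y : Set X}
    (hα : ∀ g x y, α.act g (x + y) = α.act g x + y) (h : HasCampbellFormula m α μ Y lam)
    (hmeas : ∀ F : G × X × X → ℝ≥0∞, Measurable F →
      Measurable (returnSum α.onFst ((fun p => p.1 - p.2) ⁻¹' Y) F)) :
    HasCampbellFormula m α.onFst (μ.prod μ') ((fun p => p.1 - p.2) ⁻¹' Y)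
      ((lam.prod μ').map (shearEquiv X)) := fun F hF => by
  have hshear : Measurable fun p : G × X × X => F (p.1, shearEquiv X p.2) :=
    hF.comp (measurable_fst.prodMk ((shearEquiv X).measurable.comp measurable_snd))
  have hmap : m.prod ((lam.prod μ').map (shearEquiv X)) =
      (m.prod (lam.prod μ')).map (Prod.map id (shearEquiv X)) := by
    rw [← Measure.map_prod_map _ _ measurable_id (shearEquiv X).measurable, Measure.map_id]
  calc ∫⁻ p, F p ∂(m.prod ((lam.prod μ').map (shearEquiv X)))
      = ∫⁻ p, F (p.1, shearEquiv X p.2) ∂(m.prod (lam.prod μ')) := by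
        rw [hmap, lintegral_map hF (measurable_id.prodMap (shearEquiv X).measurable)]
        rfl
    _ = ∫⁻ p, F (p.1.1, p.1.2 + p.2, p.2) ∂((m.prod lam).prod μ') :=
        ((measurePreserving_prodAssoc m lam μ').lintegral_comp hshear).symm
    _ = ∫⁻ y, ∫⁻ p, F (p.1, p.2 + y, y) ∂(m.prod lam) ∂μ' :=
        lintegral_prod_symm _
          (hshear.comp MeasurableEquiv.prodAssoc.measurable).aemeasurable
    _ = ∫⁻ y, ∫⁻ x, returnSum α Y (fun p => F (p.1, p.2 + y, y)) (x - y) ∂μ ∂μ' :=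
        lintegral_congr fun y => by
          rw [lintegral_sub_right_eq_self (returnSum α Y fun p => F (p.1, p.2 + y, y)) y]
          exact h _ (hF.comp (measurable_fst.prodMk
            ((measurable_snd.add_const y).prodMk measurable_const)))
    _ = ∫⁻ p, returnSum α.onFst ((fun p => p.1 - p.2) ⁻¹' Y) F p ∂(μ.prod μ') := by
        rw [lintegral_prod_symm _ (hmeas F hF).aemeasurable]
        simp_rw [returnSum_onFst_preimage_sub hα]

end Shear

-- Mathlib states its results on measures on quotient groups for the right translation action.
theorem isAddFundamentalDomain_op {A : Type*} [AddCommGroup A] [MeasurableSpace A] {m : Measure A}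
    {Γ : AddSubgroup A} {F : Set A} (hF : IsAddFundamentalDomain Γ F m) :
    IsAddFundamentalDomain Γ.op F m :=
  hF.preimage_of_equiv (f := id) (Measure.QuasiMeasurePreserving.id m)
    (AddSubgroup.equivOp Γ).bijective fun γ x => add_comm x (γ : A)

namespace IsLattice

variable {A : Type*} [AddCommGroup A] [TopologicalSpace A] [MeasurableSpace A]
  {m : Measure A} {Γ : AddSubgroup A}

theorem countable [SecondCountableTopology A] (hΓ : IsLattice m Γ) : Countable Γ := by
  have := hΓ.discrete
  exact countable_of_Lindelof_of_discrete

theorem finite_inter [IsTopologicalAddGroup A] [T2Space A] (hΓ : IsLattice m Γ) {C : Set A}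
    (hC : IsCompact C) : ((Γ : Set A) ∩ C).Finite := by
  have := hΓ.discrete
  have hd : IsDiscrete (Γ : Set A) := ⟨this⟩
  exact (hC.inter_left AddSubgroup.isClosed_of_discrete).finite (hd.mono inter_subset_left)

section Covolume

variable [SecondCountableTopology A] [MeasurableAdd A] [m.IsAddLeftInvariant]

theorem addCovolume_ne_zero [NeZero m] (hΓ : IsLattice m Γ) : addCovolume Γ A m ≠ 0 := by
  have := hΓ.countable
  obtain ⟨F, hF, -⟩ := hΓ.finite_covolume
  rw [hF.covolume_eq_volume]
  exact hF.measure_ne_zero (NeZero.ne m)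

theorem addCovolume_ne_top (hΓ : IsLattice m Γ) : addCovolume Γ A m ≠ ∞ := by
  have := hΓ.countable
  obtain ⟨F, hF, hFtop⟩ := hΓ.finite_covolume
  rw [hF.covolume_eq_volume]
  exact hFtop.ne

end Covolume

section Quotient

variable [IsTopologicalAddGroup A] [LocallyCompactSpace A] [SecondCountableTopology A]
  [T2Space A] [BorelSpace A] [m.IsAddHaarMeasure]

theorem isFiniteMeasure_quotient (hΓ : IsLattice m Γ) (μ : Measure (A ⧸ Γ))
    [μ.IsAddHaarMeasure] : IsFiniteMeasure μ := by
  have := hΓ.discrete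
  have := hΓ.countable
  have := polishSpace_of_lcsc A
  have hclosed : IsClosed (Γ : Set A) := AddSubgroup.isClosed_of_discrete
  obtain ⟨F, hF, hFtop⟩ := hΓ.finite_covolume
  have hFop := isAddFundamentalDomain_op hF
  have : HasAddFundamentalDomain Γ.op A m := ⟨⟨F, hFop⟩⟩
  let ρ : Measure (A ⧸ Γ) := (m.restrict F).map QuotientAddGroup.mk
  have : AddQuotientMeasureEqMeasurePreimage m ρ :=
    hFop.addQuotientMeasureEqMeasurePreimage_addQuotientMeasure
  have : IsFiniteMeasure (m.restrict F) := ⟨by rwa [Measure.restrict_apply_univ]⟩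
  have : ρ.IsAddHaarMeasure := AddQuotientMeasureEqMeasurePreimage.addHaarMeasure_quotient m
  rw [Measure.isAddLeftInvariant_eq_smul μ ρ]
  infer_instance

theorem exists_measurePreserving_mk (hΓ : IsLattice m Γ) (μ : Measure (A ⧸ Γ))
    [IsProbabilityMeasure μ] [μ.IsAddLeftInvariant] :
    ∃ F : Set A, IsAddFundamentalDomain Γ F m ∧
      MeasurePreserving QuotientAddGroup.mk (m.restrict F) (addCovolume Γ A m • μ) := by
  have := hΓ.discrete
  have := hΓ.countable
  have := polishSpace_of_lcsc A
  have hclosed : IsClosed (Γ : Set A) := AddSubgroup.isClosed_of_discrete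
  obtain ⟨F, hF, -⟩ := hΓ.finite_covolume
  have hFop := isAddFundamentalDomain_op hF
  have : HasAddFundamentalDomain Γ.op A m := ⟨⟨F, hFop⟩⟩
  have : IsFiniteMeasure (addCovolume Γ A m • μ) := μ.smul_finite hΓ.addCovolume_ne_top
  have : AddQuotientMeasureEqMeasurePreimage m (addCovolume Γ A m • μ) :=
    leftInvariantIsAddQuotientMeasureEqMeasurePreimage m (by
      simp [hF.covolume_eq_volume, hFop.covolume_eq_volume])
  exact ⟨F, hF, hFop.measurePreserving_add_quotient_mk _⟩

theorem lintegral_quotient (hΓ : IsLattice m Γ) {μ : Measure (A ⧸ Γ)}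
    [IsProbabilityMeasure μ] [μ.IsAddLeftInvariant] {φ : A → ℝ≥0∞} (hφ : Measurable φ)
    {ψ : A ⧸ Γ → ℝ≥0∞} (h : ∀ p : A, ψ p = ∑' γ : Γ, φ (γ +ᵥ p)) :
    ∫⁻ x, ψ x ∂μ = (addCovolume Γ A m)⁻¹ * ∫⁻ p, φ p ∂m := by
  have := hΓ.countable
  obtain ⟨F, hF, hmk⟩ := hΓ.exists_measurePreserving_mk μ
  have hmeas : ∀ γ : Γ, Measurable fun p : A => φ (γ +ᵥ p) := fun γ =>
    hφ.comp (measurable_const_vadd γ)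
  have hψ : Measurable ψ := QuotientAddGroup.measurable_from_quotient.2 <| by
    rw [show ψ ∘ QuotientAddGroup.mk = _ from funext h]
    exact .tsum hmeas
  have hunfold : addCovolume Γ A m * ∫⁻ x, ψ x ∂μ = ∫⁻ p, φ p ∂m := calc
    addCovolume Γ A m * ∫⁻ x, ψ x ∂μ = ∫⁻ p in F, ψ p ∂m := by
      rw [hmk.lintegral_comp hψ, lintegral_smul_measure, smul_eq_mul]
    _ = ∫⁻ p, φ p ∂m := by
      simp_rw [h]
      rw [lintegral_tsum fun γ => (hmeas γ).aemeasurable, hF.lintegral_eq_tsum'' φ]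
  rw [← hunfold, ← mul_assoc, ENNReal.inv_mul_cancel hΓ.addCovolume_ne_zero hΓ.addCovolume_ne_top,
    one_mul]

end Quotient

end IsLattice

theorem isCompact_sub {A : Type*} [AddGroup A] [TopologicalSpace A] [IsTopologicalAddGroup A]
    {K L : Set A} (hK : IsCompact K) (hL : IsCompact L) : IsCompact (K - L) := by
  rw [sub_eq_add_neg]
  exact hK.add hL.neg

namespace CutAndProjectScheme

section Basic

variable {G H : Type*}
  [AddCommGroup G] [TopologicalSpace G] [MeasurableSpace G]
  [AddCommGroup H] [TopologicalSpace H] [MeasurableSpace H]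
  {mG : Measure G} {mH : Measure H} (S : CutAndProjectScheme mG mH)

/-- The parametrization `h ↦ Γ(0, h)` of the cross sections by the internal space, so that `Y_W`
is the image of `W`. -/
def ofInternal (h : H) : S.Space := QuotientAddGroup.mk (0, h)

theorem crossSection_mono {W W' : Set H} (h : W ⊆ W') : S.crossSection W ⊆ S.crossSection W' :=
  image_mono h

theorem mk_vadd (γ : S.Γ) (p : G × H) :
    (QuotientAddGroup.mk (γ +ᵥ p) : S.Space) = QuotientAddGroup.mk p :=
  QuotientAddGroup.eq.2 <| by
    rw [AddSubgroup.vadd_def, vadd_eq_add, neg_add_rev, neg_add_cancel_comm]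
    exact S.Γ.neg_mem γ.2

theorem exists_vadd_eq_of_mk_eq {p q : G × H}
    (h : (QuotientAddGroup.mk p : S.Space) = QuotientAddGroup.mk q) : ∃ γ : S.Γ, γ +ᵥ p = q :=
  ⟨⟨-p + q, QuotientAddGroup.eq.1 h⟩, neg_add_cancel_comm p q⟩

theorem vadd_fst_injective (p : G × H) : Function.Injective fun γ : S.Γ => (γ +ᵥ p).1 :=
  fun γ γ' h => Subtype.ext (S.injOn_fst γ.2 γ'.2 (add_right_cancel h))

theorem ofInternal_injective : Function.Injective S.ofInternal := fun h h' hh => by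
  obtain ⟨γ, hγ⟩ := S.exists_vadd_eq_of_mk_eq hh
  obtain rfl : γ = 0 := S.vadd_fst_injective (0, h) (by simp [hγ])
  simpa using congrArg Prod.snd hγ

theorem mk_mem_crossSection_iff {W : Set H} {p : G × H} :
    QuotientAddGroup.mk p ∈ S.crossSection W ↔ ∃ γ : S.Γ, (γ +ᵥ p).1 = 0 ∧ (γ +ᵥ p).2 ∈ W := by
  constructor
  · rintro ⟨w, hw, h⟩
    obtain ⟨γ, hγ⟩ := S.exists_vadd_eq_of_mk_eq h.symm
    exact ⟨γ, by rw [hγ], by rwa [hγ]⟩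
  · rintro ⟨γ, hγ, hW⟩
    exact ⟨_, hW, .trans (congrArg _ (Prod.ext hγ.symm rfl)) (S.mk_vadd γ p)⟩

theorem exists_vadd_snd_mem [ContinuousAdd H] {U : Set H} (hU : IsOpen U) (hne : U.Nonempty)
    (p : G × H) : ∃ γ : S.Γ, (γ +ᵥ p).2 ∈ U := by
  obtain ⟨u, hu⟩ := hne
  obtain ⟨_, ⟨γ, hγ, rfl⟩, h⟩ := S.dense_snd.exists_mem_open
    (hU.preimage (continuous_add_const p.2)) ⟨u - p.2, by simpa using hu⟩
  exact ⟨⟨γ, hγ⟩, h⟩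

end Basic

variable {G H : Type*}
  [AddCommGroup G] [TopologicalSpace G] [IsTopologicalAddGroup G] [LocallyCompactSpace G]
  [SecondCountableTopology G] [T2Space G] [MeasurableSpace G] [BorelSpace G]
  [AddCommGroup H] [TopologicalSpace H] [IsTopologicalAddGroup H] [LocallyCompactSpace H]
  [SecondCountableTopology H] [T2Space H] [MeasurableSpace H] [BorelSpace H]
  {mG : Measure G} {mH : Measure H} (S : CutAndProjectScheme mG mH)

theorem measurable_mk : Measurable (QuotientAddGroup.mk : G × H → S.Space) :=
  QuotientAddGroup.continuous_mk.measurable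

theorem measurableEmbedding_ofInternal : MeasurableEmbedding S.ofInternal := by
  have := polishSpace_of_lcsc H
  exact (QuotientAddGroup.continuous_mk.comp (by fun_prop)).measurableEmbedding
    S.ofInternal_injective

theorem measurableSet_crossSection {W : Set H} (hW : MeasurableSet W) :
    MeasurableSet (S.crossSection W) :=
  S.measurableEmbedding_ofInternal.measurableSet_image' hW

instance : StandardBorelSpace S.Space := by
  have := polishSpace_of_lcsc S.Space
  infer_instance

instance : MeasurableSpace.CountablySeparated (S.Space × S.Space) := by
  have : StandardBorelSpace (S.Space × S.Space) := StandardBorelSpace.prod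
  exact MeasurableSpace.countablySeparated_of_separatesPoints

theorem action_mk (g : G) (p : G × H) :
    S.action.act g (QuotientAddGroup.mk p) = QuotientAddGroup.mk (p.1 - g, p.2) := by
  change (QuotientAddGroup.mk p : S.Space) + QuotientAddGroup.mk (-g, 0) = _
  rw [← QuotientAddGroup.mk_add, Prod.add_def, ← sub_eq_add_neg, add_zero]

theorem action_add (g : G) (x y : S.Space) : S.action.act g (x + y) = S.action.act g x + y :=
  add_right_comm x y _

theorem mem_returnTimes_mk_iff {W : Set H} {p : G × H} {g : G} :
    g ∈ returnTimes S.action (S.crossSection W) (QuotientAddGroup.mk p) ↔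
      ∃ γ : S.Γ, (γ +ᵥ p).1 = g ∧ (γ +ᵥ p).2 ∈ W := by
  rw [returnTimes, mem_ofPred_eq, action_mk, mk_mem_crossSection_iff]
  refine exists_congr fun γ => and_congr_left' ?_
  rw [← sub_eq_zero (b := g)]
  simp only [AddSubgroup.vadd_def, vadd_eq_add, Prod.fst_add, add_sub_assoc]

theorem returnSum_crossSection_univ_mk (F : G × S.Space → ℝ≥0∞) (p : G × H) :
    returnSum S.action (S.crossSection univ) F (QuotientAddGroup.mk p) =
      ∑' γ : S.Γ, F (-(γ +ᵥ p).1, S.ofInternal (γ +ᵥ p).2) := by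
  have hbij : Function.Bijective fun γ : S.Γ =>
      (⟨(γ +ᵥ p).1, S.mem_returnTimes_mk_iff.2 ⟨γ, rfl, mem_univ _⟩⟩ :
        returnTimes S.action (S.crossSection univ) (QuotientAddGroup.mk p)) := by
    refine ⟨fun γ γ' h => S.vadd_fst_injective p (congrArg Subtype.val h), fun ⟨g, hg⟩ => ?_⟩
    obtain ⟨γ, hγ, -⟩ := S.mem_returnTimes_mk_iff.1 hg
    exact ⟨γ, Subtype.ext hγ⟩
  rw [returnSum, ← (Equiv.ofBijective _ hbij).tsum_eq]
  refine tsum_congr fun γ => ?_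
  have hact : S.action.act (γ +ᵥ p).1 (QuotientAddGroup.mk p) = S.ofInternal (γ +ᵥ p).2 := by
    rw [← S.mk_vadd γ p, action_mk, sub_self, ofInternal]
  simp only [Equiv.ofBijective_apply, hact]

theorem measurable_returnSum_onFst {F : G × S.Space × S.Space → ℝ≥0∞} (hF : Measurable F) :
    Measurable (returnSum S.action.onFst
      ((fun p : S.Space × S.Space => p.1 - p.2) ⁻¹' S.crossSection univ) F) := by
  have := polishSpace_of_lcsc G
  have := polishSpace_of_lcsc H
  have := S.isLattice.countable
  have hofInternal := S.measurableEmbedding_ofInternal.measurable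
  rw [← ((shearEquiv S.Space).measurable.comp
    (S.measurable_mk.prodMap measurable_id)).measurable_comp_iff_of_surjective
    ((shearEquiv S.Space).surjective.comp
      (QuotientAddGroup.mk_surjective.prodMap Function.surjective_id))]
  have hcomp : returnSum S.action.onFst
      ((fun p : S.Space × S.Space => p.1 - p.2) ⁻¹' S.crossSection univ) F ∘
        shearEquiv S.Space ∘ Prod.map QuotientAddGroup.mk id = fun q : (G × H) × S.Space =>
      ∑' γ : S.Γ, F (-(γ +ᵥ q.1).1, S.ofInternal (γ +ᵥ q.1).2 + q.2, q.2) := by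
    ext ⟨p, y⟩
    change returnSum _ _ _ (QuotientAddGroup.mk p + y, y) = _
    rw [returnSum_onFst_preimage_sub S.action_add, add_sub_cancel_right,
      returnSum_crossSection_univ_mk]
  rw [hcomp]
  refine .tsum fun γ => hF.comp ?_
  have hγ : Measurable fun q : (G × H) × S.Space => γ +ᵥ q.1 := measurable_fst.const_vadd γ
  exact hγ.fst.neg.prodMk (((hofInternal.comp hγ.snd).add measurable_snd).prodMk measurable_snd)

theorem isCrossSection_crossSection {W : Set H} (hW : MeasurableSet W)
    (hc : IsCompact (closure W)) (hint : (interior W).Nonempty) :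
    IsCrossSection S.action (S.crossSection W) where
  measurableSet := S.measurableSet_crossSection hW
  nonempty x := by
    obtain ⟨p, rfl⟩ := QuotientAddGroup.mk_surjective x
    obtain ⟨γ, hγ⟩ := S.exists_vadd_snd_mem isOpen_interior hint p
    exact ⟨_, S.mem_returnTimes_mk_iff.2 ⟨γ, rfl, interior_subset hγ⟩⟩
  locallyFinite x K hK := by
    obtain ⟨p, rfl⟩ := QuotientAddGroup.mk_surjective x
    have hcomp : IsCompact ((· + p) ⁻¹' (K ×ˢ closure W)) :=
      (Homeomorph.addRight p).isCompact_preimage.2 (hK.prod hc)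
    refine ((S.isLattice.finite_inter hcomp).image fun γ => (γ + p).1).subset ?_
    rintro g ⟨hg, hgK⟩
    obtain ⟨γ, rfl, hγ⟩ := S.mem_returnTimes_mk_iff.1 hg
    exact ⟨γ, ⟨γ.2, hgK, subset_closure hγ⟩, rfl⟩

theorem measurableSet_intersectionSection {W : Set H} (hW : MeasurableSet W) :
    MeasurableSet (intersectionSection S.action (S.crossSection W)) := by
  have := polishSpace_of_lcsc G
  have := polishSpace_of_lcsc H
  have := S.isLattice.countable
  rw [← (S.measurable_mk.prodMap S.measurable_mk).measurableSet_preimage_iff_of_surjective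
    (QuotientAddGroup.mk_surjective.prodMap QuotientAddGroup.mk_surjective)]
  have hpre : Prod.map QuotientAddGroup.mk QuotientAddGroup.mk ⁻¹'
      intersectionSection S.action (S.crossSection W) = ⋃ (γ : S.Γ) (γ' : S.Γ),
        {q : (G × H) × (G × H) | (γ +ᵥ q.1).1 = (γ' +ᵥ q.2).1 ∧
          (γ +ᵥ q.1).2 ∈ W ∧ (γ' +ᵥ q.2).2 ∈ W} := by
    ext q
    simp only [mem_preimage, mem_intersectionSection_iff, Prod.map, Set.Nonempty, mem_inter_iff,
      mem_returnTimes_mk_iff, mem_iUnion, mem_ofPred_eq]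
    constructor
    · rintro ⟨_, ⟨γ, rfl, hγ⟩, γ', h, hγ'⟩
      exact ⟨γ, γ', h.symm, hγ, hγ'⟩
    · rintro ⟨γ, γ', h, hγ, hγ'⟩
      exact ⟨_, ⟨γ, rfl, hγ⟩, γ', h.symm, hγ'⟩
  rw [hpre]
  refine .iUnion fun γ => .iUnion fun γ' => ?_
  have hγ : Measurable fun q : (G × H) × (G × H) => γ +ᵥ q.1 := measurable_fst.const_vadd γ
  have hγ' : Measurable fun q : (G × H) × (G × H) => γ' +ᵥ q.2 := measurable_snd.const_vadd γ'
  exact (measurableSet_eq_fun hγ.fst hγ'.fst).inter ((hγ.snd hW).inter (hγ'.snd hW))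

theorem intersectionSection_subset (W : Set H) :
    intersectionSection S.action (S.crossSection W) ⊆
      (fun q => q.1 - q.2) ⁻¹' S.crossSection (W - W) := by
  rintro _ ⟨g, _, ⟨w, hw, rfl⟩, _, ⟨w', hw', rfl⟩, rfl⟩
  refine ⟨w - w', sub_mem_sub hw hw', ?_⟩
  simp only [action_mk, ← QuotientAddGroup.mk_sub, Prod.mk_sub_mk, sub_self]

theorem preimage_sub_subset_intersectionSection {U : Set H} (hU : IsOpen U) :
    (fun q => q.1 - q.2) ⁻¹' S.crossSection (U - U) ⊆
      intersectionSection S.action (S.crossSection U) := by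
  rintro ⟨x, y⟩ ⟨_, ⟨a, ha, b, hb, rfl⟩, hxy⟩
  obtain ⟨p, rfl⟩ := QuotientAddGroup.mk_surjective y
  obtain rfl : x = QuotientAddGroup.mk ((0, a - b) + p) := by
    rw [QuotientAddGroup.mk_add]
    exact (add_eq_of_eq_sub hxy).symm
  -- Density produces a common return time: a translate of `p` by `Γ` with `H`-coordinate near `b`.
  obtain ⟨γ, hγ, hγ'⟩ := S.exists_vadd_snd_mem
    (hU.inter (hU.preimage (continuous_const_add (a - b)))) ⟨b, hb, by simpa using ha⟩ p
  refine mem_intersectionSection_iff.2 ⟨(γ +ᵥ p).1, S.mem_returnTimes_mk_iff.2 ⟨γ, ?_, ?_⟩,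
    S.mem_returnTimes_mk_iff.2 ⟨γ, rfl, hγ⟩⟩
  · simp [AddSubgroup.vadd_def]
  · simpa [AddSubgroup.vadd_def, add_left_comm] using hγ'

theorem preimage_sub_interior_subset_intersectionSection (W : Set H) :
    (fun q => q.1 - q.2) ⁻¹' S.crossSection (interior W - interior W) ⊆
      intersectionSection S.action (S.crossSection W) :=
  (S.preimage_sub_subset_intersectionSection isOpen_interior).trans
    (intersectionSection_mono (S.crossSection_mono interior_subset))

theorem isCrossSection_intersectionSection {W : Set H} (hW : MeasurableSet W)
    (hc : IsCompact (closure W)) (hint : (interior W).Nonempty) :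
    IsCrossSection S.action.onFst (intersectionSection S.action (S.crossSection W)) := by
  have hopen : IsOpen (interior W - interior W) := isOpen_interior.sub_left
  have hcompact := isCompact_sub hc hc
  have hsub : interior W - interior W ⊆ closure W - closure W :=
    sub_subset_sub interior_subset_closure interior_subset_closure
  have hne : (interior W - interior W).Nonempty := hint.sub hint
  have hinner := S.isCrossSection_crossSection hopen.measurableSet
    (hcompact.closure_of_subset hsub) (by rwa [hopen.interior_eq])
  have houter := S.isCrossSection_crossSection hcompact.measurableSet
    (by rwa [hcompact.isClosed.closure_eq]) (hne.mono (interior_maximal hsub hopen))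
  exact (hinner.preimage_sub S.action_add).of_subset_of_subset (houter.preimage_sub S.action_add)
    (S.measurableSet_intersectionSection hW)
    (S.preimage_sub_interior_subset_intersectionSection W)
    ((S.intersectionSection_subset W).trans
      (preimage_mono (S.crossSection_mono (sub_subset_sub subset_closure subset_closure))))

/-- The measure `covol⁻¹ • m_H`, transported to `Ξ` along `h ↦ Γ(0, h)`: the transverse measure of
the section `{Γ(0, h) | h ∈ H}`, whose restriction to `Y_W` is the transverse measure of `Y_W`. -/
noncomputable def internalMeasure : Measure S.Space := S.covol⁻¹ • mH.map S.ofInternal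

theorem internalMeasure_crossSection (W : Set H) :
    S.internalMeasure (S.crossSection W) = S.covol⁻¹ * mH W := by
  rw [internalMeasure, Measure.smul_apply, smul_eq_mul, S.measurableEmbedding_ofInternal.map_apply]
  exact congrArg _ (congrArg mH (preimage_image_eq W S.ofInternal_injective))

instance : S.haarProb.IsAddLeftInvariant := by
  unfold haarProb
  infer_instance

theorem measurePreserving_action (g : G) :
    MeasurePreserving (S.action.act g) S.haarProb S.haarProb :=
  measurePreserving_add_right S.haarProb (QuotientAddGroup.mk (-g, 0))

variable [mG.IsAddHaarMeasure] [mH.IsAddHaarMeasure]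

instance : IsProbabilityMeasure S.haarProb := by
  have := S.isLattice.isFiniteMeasure_quotient (Measure.addHaar : Measure S.Space)
  unfold haarProb
  infer_instance

instance : SFinite S.internalMeasure := by
  unfold internalMeasure
  infer_instance

theorem internalMeasure_crossSection_ne_top {W : Set H} (hc : IsCompact (closure W)) :
    S.internalMeasure (S.crossSection W) ≠ ∞ := by
  rw [internalMeasure_crossSection]
  exact ENNReal.mul_ne_top (ENNReal.inv_ne_top.2 S.isLattice.addCovolume_ne_zero)
    ((measure_mono subset_closure).trans_lt hc.measure_lt_top).ne

theorem hasCampbellFormula :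
    HasCampbellFormula mG S.action S.haarProb (S.crossSection univ) S.internalMeasure :=
  fun F hF => by
  have hofInternal := S.measurableEmbedding_ofInternal.measurable
  have hmap : mG.prod (mH.map S.ofInternal) = (mG.prod mH).map (Prod.map id S.ofInternal) := by
    rw [← Measure.map_prod_map _ _ measurable_id hofInternal, Measure.map_id]
  have hneg : MeasurePreserving (Prod.map Neg.neg id : G × H → G × H)
      (mG.prod mH) (mG.prod mH) :=
    (Measure.measurePreserving_neg mG).prod (.id mH)
  have hmeas : Measurable fun p : G × H => F (p.1, S.ofInternal p.2) :=
    hF.comp (measurable_id.prodMap hofInternal)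
  calc ∫⁻ p, F p ∂(mG.prod S.internalMeasure)
      = S.covol⁻¹ * ∫⁻ p, F (p.1, S.ofInternal p.2) ∂(mG.prod mH) := by
        rw [internalMeasure, Measure.prod_smul_right, lintegral_smul_measure, smul_eq_mul, hmap,
          lintegral_map hF (measurable_id.prodMap hofInternal)]
        rfl
    _ = S.covol⁻¹ * ∫⁻ p, F (-p.1, S.ofInternal p.2) ∂(mG.prod mH) := by
        rw [← hneg.lintegral_comp hmeas]
        rfl
    _ = ∫⁻ x, returnSum S.action (S.crossSection univ) F x ∂S.haarProb :=
        (S.isLattice.lintegral_quotient (hmeas.comp hneg.measurable)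
          (S.returnSum_crossSection_univ_mk F)).symm

/-- The transverse measure of the pairs whose difference lies in `{Γ(0, h) | h ∈ H}`, as a measure
on `Ξ × Ξ`. Its restriction to `Y_W^[2]` is the transverse measure of `Y_W^[2]`. -/
noncomputable def pairMeasure : Measure (S.Space × S.Space) :=
  (S.internalMeasure.prod S.haarProb).map (shearEquiv S.Space)

instance : SFinite S.pairMeasure := by
  unfold pairMeasure
  infer_instance

theorem hasCampbellFormula_onFst :
    HasCampbellFormula mG S.action.onFst (S.haarProb.prod S.haarProb)
      ((fun p : S.Space × S.Space => p.1 - p.2) ⁻¹' S.crossSection univ) S.pairMeasure :=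
  S.hasCampbellFormula.onFst_preimage_sub S.action_add fun _ => S.measurable_returnSum_onFst

theorem pairMeasure_preimage_sub (W : Set H) :
    S.pairMeasure ((fun p => p.1 - p.2) ⁻¹' S.crossSection W) = S.covol⁻¹ * mH W := by
  rw [pairMeasure, map_shearEquiv_preimage_sub, measure_univ, mul_one,
    internalMeasure_crossSection]

theorem pairMeasure_intersectionSection_le (W : Set H) :
    S.pairMeasure (intersectionSection S.action (S.crossSection W)) ≤
      S.covol⁻¹ * mH (W - W) :=
  (measure_mono (S.intersectionSection_subset W)).trans_eq (S.pairMeasure_preimage_sub (W - W))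

theorem le_pairMeasure_intersectionSection (W : Set H) :
    S.covol⁻¹ * mH (interior W - interior W) ≤
      S.pairMeasure (intersectionSection S.action (S.crossSection W)) :=
  (S.pairMeasure_preimage_sub _).ge.trans
    (measure_mono (S.preimage_sub_interior_subset_intersectionSection W))

theorem pairMeasure_intersectionSection_ne_top {W : Set H} (hc : IsCompact (closure W)) :
    S.pairMeasure (intersectionSection S.action (S.crossSection W)) ≠ ∞ := by
  have hcompact : IsCompact (closure (W - W)) := (isCompact_sub hc hc).closure_of_subset
    (sub_subset_sub subset_closure subset_closure)
  refine ne_top_of_le_ne_top ?_ (S.pairMeasure_intersectionSection_le W)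
  rw [← internalMeasure_crossSection]
  exact S.internalMeasure_crossSection_ne_top hcompact

theorem intensity_crossSection {W : Set H} (hW : MeasurableSet W) (hc : IsCompact (closure W)) :
    intensity mG S.action S.haarProb (S.crossSection W) = S.covol⁻¹ * mH W := by
  rw [S.hasCampbellFormula.intensity_eq (S.crossSection_mono (subset_univ W))
      (S.measurableSet_crossSection hW) (S.internalMeasure_crossSection_ne_top hc),
    internalMeasure_crossSection]

end CutAndProjectScheme

theorem IsJordanMeasurable.measure_interior {H : Type*} [TopologicalSpace H] [MeasurableSpace H]
    {m : Measure H} {W : Set H} (hW : IsJordanMeasurable m W) : m (interior W) = m W :=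
  measure_congr (interior_ae_eq_of_null_frontier hW)

theorem IsWindow.interior_nonempty {H : Type*} [TopologicalSpace H] [MeasurableSpace H]
    {m : Measure H} {W : Set H} (hW : IsWindow m W) : (interior W).Nonempty :=
  nonempty_of_measure_ne_zero (hW.jordan.measure_interior.trans_ne hW.measure_pos.ne')

theorem theoremB_general {G H : Type*}
    [AddCommGroup G] [TopologicalSpace G] [IsTopologicalAddGroup G] [LocallyCompactSpace G]
    [SecondCountableTopology G] [T2Space G] [MeasurableSpace G] [BorelSpace G]
    [AddCommGroup H] [TopologicalSpace H] [IsTopologicalAddGroup H] [LocallyCompactSpace H]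
    [SecondCountableTopology H] [T2Space H] [MeasurableSpace H] [BorelSpace H]
    (mG : Measure G) [mG.IsAddHaarMeasure] (mH : Measure H) [mH.IsAddHaarMeasure]
    (S : CutAndProjectScheme mG mH) (W : Set H) (hW : MeasurableSet W)
    (hc : IsCompact (closure W)) (hint : (interior W).Nonempty) :
    (IsTransverseSpace S.action S.haarProb (S.crossSection W) ∧
      (∃! ν, IsTransverseMeasure mG S.action S.haarProb (S.crossSection W) ν) ∧
      IsTransverseSpace S.action.onFst (S.haarProb.prod S.haarProb)
        (intersectionSection S.action (S.crossSection W)) ∧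
      (∃! ν, IsTransverseMeasure mG S.action.onFst (S.haarProb.prod S.haarProb)
        (intersectionSection S.action (S.crossSection W)) ν)) ∧
    (intensity mG S.action S.haarProb (S.crossSection W) = S.covol⁻¹ * mH W ∧
      intensity mG S.action S.haarProb (S.crossSection (interior W)) =
        S.covol⁻¹ * mH (interior W)) ∧
    S.covol⁻¹ * mH (interior W - interior W) ≤
        intersectionCovolume mG S.action S.haarProb (S.crossSection W) ∧
      intersectionCovolume mG S.action S.haarProb (S.crossSection W) ≤
        S.covol⁻¹ * mH (W - W) := by
  have hci : IsCompact (closure (interior W)) :=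
    hc.closure_of_subset interior_subset_closure
  have hY := S.crossSection_mono (subset_univ W)
  have hYsec := S.isCrossSection_crossSection hW hc hint
  have hYtop := S.internalMeasure_crossSection_ne_top hc
  have hZ := (S.intersectionSection_subset W).trans
    (preimage_mono (S.crossSection_mono (subset_univ (W - W))))
  have hZsec := S.isCrossSection_intersectionSection hW hc hint
  have hZtop := S.pairMeasure_intersectionSection_ne_top hc
  have hcampbell := S.hasCampbellFormula
  have hcampbell' := S.hasCampbellFormula_onFst
  refine ⟨⟨hcampbell.isTransverseSpace S.measurePreserving_action hYsec hY hYtop,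
    (hcampbell.isTransverseMeasure_comap hY hYsec.measurableSet hYtop).existsUnique,
    hcampbell'.isTransverseSpace (fun g => (S.measurePreserving_action g).prod (.id _))
      hZsec hZ hZtop,
    (hcampbell'.isTransverseMeasure_comap hZ hZsec.measurableSet hZtop).existsUnique⟩,
    ⟨S.intensity_crossSection hW hc,
      S.intensity_crossSection isOpen_interior.measurableSet hci⟩, ?_⟩
  rw [intersectionCovolume, hcampbell'.intensity_eq hZ hZsec.measurableSet hZtop]
  exact ⟨S.le_pairMeasure_intersectionSection W, S.pairMeasure_intersectionSection_le W⟩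

theorem theoremB {G H : Type*}
    [AddCommGroup G] [TopologicalSpace G] [IsTopologicalAddGroup G] [LocallyCompactSpace G]
    [SecondCountableTopology G] [T2Space G] [MeasurableSpace G] [BorelSpace G]
    [AddCommGroup H] [TopologicalSpace H] [IsTopologicalAddGroup H] [LocallyCompactSpace H]
    [SecondCountableTopology H] [T2Space H] [MeasurableSpace H] [BorelSpace H]
    (mG : Measure G) [mG.IsAddHaarMeasure] (mH : Measure H) [mH.IsAddHaarMeasure]
    (S : CutAndProjectScheme mG mH) (W : Set H) (hW : IsWindow mH W) :
    -- the objects are well defined: both spaces are transverse, with a unique transverse measure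
    (IsTransverseSpace S.action S.haarProb (S.crossSection W) ∧
      (∃! ν, IsTransverseMeasure mG S.action S.haarProb (S.crossSection W) ν) ∧
      IsTransverseSpace S.action.onFst (S.haarProb.prod S.haarProb)
        (intersectionSection S.action (S.crossSection W)) ∧
      (∃! ν, IsTransverseMeasure mG S.action.onFst (S.haarProb.prod S.haarProb)
        (intersectionSection S.action (S.crossSection W)) ν)) ∧
    -- the intensity
    (intensity mG S.action S.haarProb (S.crossSection W) = S.covol⁻¹ * mH W ∧
      intensity mG S.action S.haarProb (S.crossSection (interior W)) =
        intensity mG S.action S.haarProb (S.crossSection W)) ∧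
    -- the intersection covolume
    (IsOpen W ∨ IsJordanMeasurable mH (W - W) →
      S.covol⁻¹ * mH (interior W - interior W) ≤
          intersectionCovolume mG S.action S.haarProb (S.crossSection W) ∧
        intersectionCovolume mG S.action S.haarProb (S.crossSection W) ≤
          S.covol⁻¹ * mH (W - W)) := by
  obtain ⟨hdef, ⟨hI, hI'⟩, hcov⟩ :=
    theoremB_general mG mH S W hW.measurableSet hW.relativelyCompact hW.interior_nonempty
  exact ⟨hdef, ⟨hI, by rw [hI, hI', hW.jordan.measure_interior]⟩, fun _ => hcov⟩
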